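/- A \emph{q.n.c. tomonoid} is a commutative monoid $({\mathcal L};\odot,1)$ with a total order such that (i) $a\le b$ and $c\le d$ imply $a\odot c\le b\odot d$, (ii) $a\le 1$ for all $a$, (iii) every non-empty subset has a supremum, and (iv) $a\odot\bigvee_\iota b_\iota=\bigvee_\iota(a\odot b_\iota)$ for every non-empty family $(b_\iota)$. A \emph{filter} $F$ of $\mathcal L$ is an upward closed submonoid. It induces the congruence $\sim_F$ given by: $a\sim_F b$ iff $a=b$, or $a<b$ and $b\odot f\le a$ for some $f\in F$, or $b<a$ and $a\odot f\le b$ for some $f\in F$. The quotient $\mathcal P$ consists of the $\sim_F$-classes (the \emph{$F$-classes}), with the induced operation $\odot$ and with the total order $R\le R'$ iff $a\le b$ for some $a\in R$, $b\in R'$; its identity is $F$. A pair $R,T\in{\mathcal P}$ is \emph{$\odot$-maximal} if $R$ is the largest $X$ with $X\odot T=R\odot T$ and $T$ is the largest $Y$ with $R\odot Y=R\odot T$. For an $F$-class $R$ and $f\in F$ let $\varrho_R(f)\colon R\to R$, $r\mapsto f\odot r$, and put $\Lambda^R=\{\varrho_R(f)\colon f\in F\}$. For $F$-classes $R,T$ and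 $S=R\odot T$ put $\Lambda^{R,S}=\{\lambda_t\colon t\in T\}$, where $\lambda_t\colon R\to S$, $r\mapsto t\odot r$. A tomonoid is \emph{Łukasiewicz} if it is isomorphic to $[0,1]$ with the natural order and the operation $a\star b=(a+b-1)\vee 0$. A \emph{composition tomonoid} on a chain $X$ is a set of order-preserving maps $X\to X$ that contains the identity, is closed under composition, and is totally ordered pointwise. A \emph{c-isomorphism} from a composition tomonoid $\Phi$ on $X$ to one, $\Psi$, on $Y$ is an order isomorphism $\varphi\colon X\to Y$ with $\Psi=\{\varphi\circ\lambda\circ\varphi^{-1}\colon\lambda\in\Phi\}$. A composition tomonoid is \emph{Łukasiewicz} if it is c-isomorphic to the set $\Phi^{\text{Łu}}$ of all maps $[0,1]\to[0,1]$, $x\mapsto (x+t-1)\vee 0$, $t\in[0,1]$. \textbf{Theorem.} Let $\mathcal L$ be a q.n.c. tomonoid and let $F\neq\{1\}$ be a filter of $\mathcal L$ that is Archimedean (for all $a,b\in F$ with $a<b<1$ there is an $n\ge 1$ with $b^n\le a$). Let $\mathcal P$ be the quotient of $\mathcal L$ by $F$, and assume that every $F$-class is order-isomorphic to a real interval, that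 is, to a singleton or to an open, half-open or closed interval of $\mathbb R$ with end points $a<b$ in $\mathbb R$. Let $F$ have a smallest element. Let $R,T\in\mathcal P$ with $T<F$ be $\odot$-maximal, let $S=R\odot T$, and assume that neither $R$ nor $S$ is a singleton. Then $F$ is a Łukasiewicz tomonoid, and $\Lambda^R$ and $\Lambda^S$ are Łukasiewicz composition tomonoids. Moreover, for any identification of $F$ with $([0,1];\le,\star,1)$ by a tomonoid isomorphism, and any identifications of $R$ and $S$ with $[0,1]$ by c-isomorphisms of $\Lambda^R$ and $\Lambda^S$ with $\Phi^{\text{Łu}}$, there are $\alpha_R,\alpha_S\ge 1$ such that, for all $f\in F$ and $r\in[0,1]$, \[ \varrho_R(f)(r)=(r+\alpha_R(f-1))\vee 0,\qquad \varrho_S(f)(r)=(r+\alpha_S(f-1))\vee 0, \] and there is an $m\in\bigl[-\tfrac{\alpha_S}{\alpha_R},\,(1-\tfrac{\alpha_S}{\alpha_R})\wedge 0\bigr]$ such that $\Lambda^{R,S}$ is exactly the set of the maps \[ \lambda_z\colon[0,1]\to[0,1],\quad r\mapsto\bigl(\tfrac{\alpha_S}{\alpha_R}\,r+z\bigr)\vee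 0,\qquad -\tfrac{\alpha_S}{\alpha_R}\le z\le m. \] -/

import Mathlib

/-- A quantic, negative, commutative totally ordered monoid (q.n.c. tomonoid). Compatibility of the
product with the order is `IsOrderedMonoid`; "almost complete" means that non-empty subsets have
suprema. -/
class QNCTomonoid (L : Type*) [CommMonoid L] [LinearOrder L] : Prop extends IsOrderedMonoid L where
  /-- negativity -/
  le_one' : ∀ a : L, a ≤ 1
  /-- almost completeness -/
  exists_isLUB : ∀ A : Set L, A.Nonempty → ∃ b, IsLUB A b
  /-- multiplication distributes over suprema of non-empty sets -/
  mul_isLUB : ∀ (a : L) (A : Set L) (b : L), A.Nonempty → IsLUB A b →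
    IsLUB ((fun x => a * x) '' A) (a * b)

/-- A tomonoid is Archimedean if `a < b < 1` implies `b ^ n ≤ a` for some `n ≥ 1`. -/
def ArchimedeanTomonoid (M : Type*) [Monoid M] [Preorder M] : Prop :=
  ∀ a b : M, a < b → b < 1 → ∃ n : ℕ, 1 ≤ n ∧ b ^ n ≤ a

/-- The pair `r, t` is `⊙`-maximal: `r` is the largest `x` with `x ⊙ t = r ⊙ t`, and `t` is the
largest `y` with `r ⊙ y = r ⊙ t`. -/
def OdotMaximal {M : Type*} [Mul M] [LE M] (r t : M) : Prop :=
  IsGreatest {x | x * t = r * t} r ∧ IsGreatest {y | r * y = r * t} t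

/-- A real interval: a singleton or a bounded interval `(a,b)`, `(a,b]`, `[a,b)`, `[a,b]`
with `a < b`. -/
def IsRealInterval (J : Set ℝ) : Prop :=
  (∃ a, J = {a}) ∨
    ∃ a b, a < b ∧ (J = Set.Ioo a b ∨ J = Set.Ioc a b ∨ J = Set.Ico a b ∨ J = Set.Icc a b)

/-- The Łukasiewicz t-norm `(a + b - 1) ∨ 0` on the real unit interval. -/
def lukMul (a b : unitInterval) : unitInterval :=
  ⟨max ((a : ℝ) + b - 1) 0, le_max_right _ _,
    max_le (by linarith [a.2.2, b.2.2]) zero_le_one⟩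

/-- `e` is an isomorphism of tomonoids from `M` onto the real unit interval with the Łukasiewicz
t-norm. -/
def IsLukasiewiczIso {M : Type*} [Monoid M] [LE M] (e : M ≃o unitInterval) : Prop :=
  e 1 = 1 ∧ ∀ f g : M, e (f * g) = lukMul (e f) (e g)

/-- A tomonoid is Łukasiewicz if it is isomorphic to the real unit interval with the Łukasiewicz
t-norm. -/
def LukasiewiczTomonoid (M : Type*) [Monoid M] [LE M] : Prop :=
  ∃ e : M ≃o unitInterval, IsLukasiewiczIso e

/-- A composition tomonoid on a chain `X`: a set of order-preserving maps that is totally ordered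
by the pointwise order, closed under composition, and contains the identity. -/
structure IsCompositionTomonoid {X : Type*} [LinearOrder X] (Φ : Set (X → X)) : Prop where
  monotone : ∀ g ∈ Φ, Monotone g
  total : ∀ g ∈ Φ, ∀ h ∈ Φ, g ≤ h ∨ h ≤ g
  comp_mem : ∀ g ∈ Φ, ∀ h ∈ Φ, g ∘ h ∈ Φ
  id_mem : id ∈ Φ

/-- The map `X' → Y'` that corresponds to `g : X → Y` when `X` is identified with `X'` by means
of `φ` and `Y` with `Y'` by means of `ψ`. -/
def transportMap {X Y X' Y' : Type*} [LE X] [LE Y] [LE X'] [LE Y']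
    (φ : X ≃o X') (ψ : Y ≃o Y') (g : X → Y) : X' → Y' :=
  ψ ∘ g ∘ φ.symm

/-- The order isomorphism `φ` is a c-isomorphism from `Φ` to `Ψ`. -/
def IsCIso {X Y : Type*} [LE X] [LE Y] (φ : X ≃o Y) (Φ : Set (X → X)) (Ψ : Set (Y → Y)) : Prop :=
  Ψ = transportMap φ φ '' Φ

/-- The Łukasiewicz composition tomonoid on `[0,1]`, consisting of the maps
`x ↦ (x + t - 1) ∨ 0`, `t ∈ [0,1]`. -/
def lukMaps : Set (unitInterval → unitInterval) :=
  Set.range fun t x => lukMul x t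

/-- `Φ` is a composition tomonoid that is Łukasiewicz, that is, c-isomorphic to `lukMaps`. -/
def LukasiewiczComposition {X : Type*} [LinearOrder X] (Φ : Set (X → X)) : Prop :=
  IsCompositionTomonoid Φ ∧ ∃ φ : X ≃o unitInterval, IsCIso φ Φ lukMaps

section FilterQuotient

variable {L : Type*} [CommMonoid L] [LinearOrder L]

/-- The relation `∼_F` induced by `F`. -/
def filterRel (F : Submonoid L) (a b : L) : Prop :=
  a = b ∨ (a < b ∧ ∃ f ∈ F, b * f ≤ a) ∨ (b < a ∧ ∃ f ∈ F, a * f ≤ b)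

theorem filterRel_iff (F : Submonoid L) (a b : L) :
    filterRel F a b ↔ (∃ f ∈ F, b * f ≤ a) ∧ ∃ f ∈ F, a * f ≤ b := by
  have key : ∀ x y : L, x ≤ y → ∃ f ∈ F, x * f ≤ y := fun x y h => ⟨1, F.one_mem, by simpa using h⟩
  constructor
  · rintro (rfl | ⟨h, h'⟩ | ⟨h, h'⟩)
    · exact ⟨key _ _ le_rfl, key _ _ le_rfl⟩
    · exact ⟨h', key _ _ h.le⟩
    · exact ⟨key _ _ h.le, h'⟩
  · rintro ⟨h, h'⟩
    rcases lt_trichotomy a b with hab | hab | hab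
    · exact Or.inr (Or.inl ⟨hab, h⟩)
    · exact Or.inl hab
    · exact Or.inr (Or.inr ⟨hab, h'⟩)

variable [QNCTomonoid L]

theorem QNCTomonoid.mul_le_self (a f : L) : a * f ≤ a := by
  simpa using mul_le_mul_right (QNCTomonoid.le_one' f) a

/-- The congruence `∼_F` induced by `F`. -/
def filterCon (F : Submonoid L) : Con L where
  r := filterRel F
  iseqv := by
    refine ⟨fun a => Or.inl rfl, fun {a b} h => ?_, fun {a b c} h h' => ?_⟩
    · rw [filterRel_iff] at h ⊢
      exact ⟨h.2, h.1⟩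
    · rw [filterRel_iff] at h h' ⊢
      obtain ⟨⟨f, hf, h1⟩, g, hg, h2⟩ := h
      obtain ⟨⟨f', hf', h3⟩, g', hg', h4⟩ := h'
      refine ⟨⟨f' * f, F.mul_mem hf' hf, ?_⟩, g * g', F.mul_mem hg hg', ?_⟩
      · rw [← mul_assoc]
        exact (mul_le_mul_left h3 f).trans h1
      · rw [← mul_assoc]
        exact (mul_le_mul_left h2 g').trans h4
  mul' := by
    intro a b c d h h'
    rw [filterRel_iff] at h h' ⊢
    obtain ⟨⟨f, hf, h1⟩, g, hg, h2⟩ := h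
    obtain ⟨⟨f', hf', h3⟩, g', hg', h4⟩ := h'
    refine ⟨⟨f * f', F.mul_mem hf hf', ?_⟩, g * g', F.mul_mem hg hg', ?_⟩
    · rw [mul_mul_mul_comm]
      exact mul_le_mul' h1 h3
    · rw [mul_mul_mul_comm]
      exact mul_le_mul' h2 h4

/-- The quotient `𝒫` of `L` by `F`, a commutative monoid. Its identity is the class of `1`, which
is `F` itself when `F` is an upper set (see `filterClass_one`). -/
abbrev FilterQuotient (F : Submonoid L) : Type _ := (filterCon F).Quotient

theorem filterQuotient_eq_iff (F : Submonoid L) (a b : L) :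
    (a : FilterQuotient F) = (b : FilterQuotient F) ↔
      (∃ f ∈ F, b * f ≤ a) ∧ ∃ f ∈ F, a * f ≤ b :=
  ((filterCon F).eq).trans (filterRel_iff F a b)

/-- `[a] ≤ [b]` if `a' ≤ b'` for some `a' ∼ a` and `b' ∼ b`. -/
instance FilterQuotient.instLE (F : Submonoid L) : LE (FilterQuotient F) where
  le x y := ∃ a b : L, (a : FilterQuotient F) = x ∧ (b : FilterQuotient F) = y ∧ a ≤ b

theorem filterQuotient_le_iff (F : Submonoid L) (a b : L) :
    (a : FilterQuotient F) ≤ (b : FilterQuotient F) ↔ ∃ f ∈ F, a * f ≤ b := by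
  constructor
  · rintro ⟨a', b', ha, hb, h⟩
    rw [filterQuotient_eq_iff] at ha hb
    obtain ⟨f, hf, h1⟩ := ha.1
    obtain ⟨g, hg, h2⟩ := hb.2
    refine ⟨f * g, F.mul_mem hf hg, ?_⟩
    rw [← mul_assoc]
    exact (mul_le_mul_left (h1.trans h) g).trans h2
  · rintro ⟨f, hf, h⟩
    refine ⟨a * f, b, ?_, rfl, h⟩
    rw [filterQuotient_eq_iff]
    exact ⟨⟨f, hf, le_rfl⟩, 1, F.one_mem, by
      rw [mul_one]; exact QNCTomonoid.mul_le_self a f⟩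

/-- The quotient is totally ordered. -/
noncomputable instance FilterQuotient.instLinearOrder (F : Submonoid L) :
    LinearOrder (FilterQuotient F) where
  le_refl x := by
    induction x using Con.induction_on with
    | H a => exact ⟨a, a, rfl, rfl, le_rfl⟩
  le_trans x y z := by
    induction x using Con.induction_on with
    | H a =>
    induction y using Con.induction_on with
    | H b =>
    induction z using Con.induction_on with
    | H c =>
    simp only [filterQuotient_le_iff]
    rintro ⟨f, hf, h⟩ ⟨g, hg, h'⟩
    refine ⟨f * g, F.mul_mem hf hg, ?_⟩
    rw [← mul_assoc]
    exact (mul_le_mul_left h g).trans h'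
  le_antisymm x y := by
    induction x using Con.induction_on with
    | H a =>
    induction y using Con.induction_on with
    | H b =>
    intro h h'
    rw [filterQuotient_le_iff] at h h'
    rw [filterQuotient_eq_iff]
    exact ⟨h', h⟩
  le_total x y := by
    induction x using Con.induction_on with
    | H a =>
    induction y using Con.induction_on with
    | H b =>
    rcases le_total a b with h | h
    · exact Or.inl ⟨a, b, rfl, rfl, h⟩
    · exact Or.inr ⟨b, a, rfl, rfl, h⟩
  toDecidableLE := Classical.decRel _

/-- An `F`-class, that is, an element of the quotient, as a subset of `L`. -/
def filterClass {F : Submonoid L} (R : FilterQuotient F) : Set L :=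
  {a | (a : FilterQuotient F) = R}

theorem coe_eq_one_of_mem {F : Submonoid L} {f : L} (hf : f ∈ F) :
    (f : FilterQuotient F) = 1 := by
  rw [← Con.coe_one, filterQuotient_eq_iff]
  exact ⟨⟨f, hf, by rw [one_mul]⟩, 1, F.one_mem, by
    rw [mul_one]; exact QNCTomonoid.le_one' f⟩

theorem filterClass_one {F : Submonoid L} (hF : IsUpperSet (F : Set L)) :
    filterClass (1 : FilterQuotient F) = (F : Set L) := by
  ext a
  refine ⟨fun h => ?_, fun h => coe_eq_one_of_mem h⟩
  have h' : (a : FilterQuotient F) = ((1 : L) : FilterQuotient F) := h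
  rw [filterQuotient_eq_iff] at h'
  obtain ⟨f, hf, h1⟩ := h'.1
  exact hF (by simpa using h1) hf

/-- The map `ϱ_R : f ↦ λ_f^R`, where `λ_f^R : R → R` is the restriction of `x ↦ f ⊙ x` to `R`. -/
def rho {F : Submonoid L} (R : FilterQuotient F) (f : F) : filterClass R → filterClass R :=
  fun r => ⟨(f : L) * r, by
    have hr : ((r : L) : FilterQuotient F) = R := r.2
    change (((f : L) * r : L) : FilterQuotient F) = R
    rw [Con.coe_mul, coe_eq_one_of_mem f.2, one_mul, hr]⟩

/-- `Λ^R = {λ_f^R : f ∈ F}`. -/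
def LambdaR {F : Submonoid L} (R : FilterQuotient F) : Set (filterClass R → filterClass R) :=
  Set.range (rho R)

/-- The map `λ_t^{R,S} : R → S`, where `S = R ⊙ T` and `t ∈ T`: the restriction of
`x ↦ t ⊙ x`. -/
def lambdaMap {F : Submonoid L} (R T : FilterQuotient F) (t : filterClass T) :
    filterClass R → filterClass (R * T) :=
  fun r => ⟨(t : L) * r, by
    have hr : ((r : L) : FilterQuotient F) = R := r.2
    have ht : ((t : L) : FilterQuotient F) = T := t.2
    change (((t : L) * r : L) : FilterQuotient F) = R * T
    rw [Con.coe_mul, ht, hr, mul_comm]⟩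

/-- `Λ^{R,S} = {λ_t^{R,S} : t ∈ T}`, where `S = R ⊙ T`. -/
def LambdaRS {F : Submonoid L} (R T : FilterQuotient F) :
    Set (filterClass R → filterClass (R * T)) :=
  Set.range (lambdaMap R T)

/-- In terms of the identifications `e` of `F` and `φ` of `R` with `[0,1]`, the map `ϱ_R` is given
by `ϱ_R(f) : r ↦ (r + α (f - 1)) ∨ 0`. -/
def RhoHasCoefficient {F : Submonoid L} (e : F ≃o unitInterval) (R : FilterQuotient F)
    (φ : filterClass R ≃o unitInterval) (α : ℝ) : Prop :=
  ∀ (f : F) (r : unitInterval),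
    ((transportMap φ φ (rho R f) r : unitInterval) : ℝ) = max ((r : ℝ) + α * ((e f : ℝ) - 1)) 0

end FilterQuotient

/-! With least element `d`, the filter is the interval `[d, 1]`, `d` is idempotent, and the
Archimedean property makes every element below `1` nilpotent relative to `d`. Nilpotency and
distributivity over suprema together replace continuity: pushing `h` up slightly and multiplying by
some `k < 1` lands below `h` again (`exists_gt_mul_le`), while factors `k < 1` may be dropped in the
limit (`le_of_forall_mul_le`). This yields divisibility (`exists_mul_eq`), cancellation above the
bottom (`mul_eq_of_mul_eq`) and square roots (`exists_sq_eq`). Iterated roots of `d` play the role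
of `1 - 2⁻ⁿ`; measuring elements by their powers gives a logarithm that turns the product into
addition truncated at `1`, and `1 - log` is the isomorphism of `F` with the Łukasiewicz tomonoid.

Every class is an interval `[d * w, w]` and, by divisibility, the orbit of its top `w` under `F`. If
`k` is the largest element with `k * w = d * w`, then `f ↦ f * w` is constant below `k` and
injective above it, so stretching the coordinates of `[k, 1]` to `[0,1]` gives `ϱ_R` with slope `α =
1 / (1 - κ)`, `κ` the coordinate of `k`. The Łukasiewicz tomonoid has no nontrivial automorphism, so
any other identification agrees with this one.

Finally, each `λ_t` commutes with the action of `F` and is therefore determined by its value at the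
top of `R`. These values fill an interval `[0, c]`, and `m = c - α_S / α_R`. -/

/-- The interval `[d, 1]` is a densely ordered submonoid whose elements `≠ 1` are nilpotent
relative to its zero element `d`. -/
structure NilpotentZero {L : Type*} [CommMonoid L] [LinearOrder L] (d : L) : Prop where
  mul_self : d * d = d
  lt_one : d < 1
  dense : ∀ a b : L, d ≤ a → a < b → ∃ c, a < c ∧ c < b
  nilpotent : ∀ x : L, x < 1 → ∃ n : ℕ, x ^ n ≤ d

/-! ### Divisibility, cancellation and square roots in `[d, 1]` -/

namespace NilpotentZero

variable {L : Type*} [CommMonoid L] [LinearOrder L] {d : L}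

/-- Otherwise multiplication by `k` would preserve `{x | h < x}`, and all powers of `k` would stay
above `h ≥ d`, against nilpotency. -/
theorem exists_gt_mul_le (H : NilpotentZero d) {h k : L} (hd : d ≤ h) (h1 : h < 1) (k1 : k < 1) :
    ∃ h', h < h' ∧ k * h' ≤ h := by
  by_contra! hc
  have key : ∀ n : ℕ, h < k ^ n := by
    intro n
    induction n with
    | zero => simpa using h1
    | succ n ih => rw [pow_succ']; exact hc _ ih
  obtain ⟨n, hn⟩ := H.nilpotent k k1
  exact absurd (hn.trans hd) (not_le.2 (key n))

variable [QNCTomonoid L]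

/-- By density `1` is the supremum of the `k < 1`, and multiplication by `x` preserves this
supremum. -/
theorem le_of_forall_mul_le (H : NilpotentZero d) {x y : L}
    (h : ∀ k, d ≤ k → k < 1 → k * x ≤ y) : x ≤ y := by
  have hlub : IsLUB {k : L | d ≤ k ∧ k < 1} 1 := by
    refine ⟨fun k hk => hk.2.le, fun b hb => ?_⟩
    by_contra! hb1
    have hdb : d ≤ b := hb ⟨le_rfl, H.lt_one⟩
    obtain ⟨c, hc, hc1⟩ := H.dense b 1 hdb hb1
    exact absurd (hb ⟨hdb.trans hc.le, hc1⟩) (not_le.2 hc)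
  have h2 := QNCTomonoid.mul_isLUB x {k : L | d ≤ k ∧ k < 1} 1 ⟨d, le_rfl, H.lt_one⟩ hlub
  rw [mul_one] at h2
  refine h2.2 ?_
  rintro _ ⟨k, hk, rfl⟩
  show x * k ≤ y
  rw [mul_comm]
  exact h k hk.1 hk.2

/-- The largest `f` in `[d, 1]` with `f * x ≤ y`. -/
theorem exists_isGreatest_mul_le {x y : L} (hxy : d * x ≤ y) :
    ∃ f, IsGreatest {f | d ≤ f ∧ f * x ≤ y} f := by
  obtain ⟨h, hh⟩ := QNCTomonoid.exists_isLUB {f | d ≤ f ∧ f * x ≤ y} ⟨d, le_rfl, hxy⟩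
  refine ⟨h, ⟨hh.1 ⟨le_rfl, hxy⟩, ?_⟩, hh.1⟩
  rw [mul_comm]
  refine (QNCTomonoid.mul_isLUB x {f | d ≤ f ∧ f * x ≤ y} h ⟨d, le_rfl, hxy⟩ hh).2 ?_
  rintro _ ⟨f, hf, rfl⟩
  show x * f ≤ y
  rw [mul_comm]
  exact hf.2

/-- Divisibility. The residual `h` works: any `h' > h` overshoots `y`, and for each `k < 1` some
such `h'` has `k * h' ≤ h`, whence `k * y ≤ h * x`. -/
theorem exists_mul_eq (H : NilpotentZero d) {x y : L} (hxy : d * x ≤ y) (hyx : y ≤ x) :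
    ∃ f, d ≤ f ∧ f * x = y := by
  obtain ⟨h, ⟨hd, hle⟩, hmax⟩ := exists_isGreatest_mul_le hxy
  refine ⟨h, hd, le_antisymm hle ?_⟩
  rcases (QNCTomonoid.le_one' h).eq_or_lt with rfl | h1
  · simpa using hyx
  refine H.le_of_forall_mul_le fun k _ hk1 => ?_
  obtain ⟨h', hlt, hkh⟩ := H.exists_gt_mul_le hd h1 hk1
  have hy : y ≤ h' * x := by
    by_contra! hc
    exact absurd (hmax ⟨hd.trans hlt.le, hc.le⟩) (not_le.2 hlt)
  calc k * y ≤ k * (h' * x) := mul_le_mul_right hy k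
    _ = k * h' * x := (mul_assoc _ _ _).symm
    _ ≤ h * x := mul_le_mul_left hkh x

theorem eq_of_mul_eq_self (H : NilpotentZero d) {h x : L} (h1 : h < 1) (hx : h * x = x) :
    x = d * x := by
  have key : ∀ n : ℕ, h ^ n * x = x := by
    intro n
    induction n with
    | zero => simp
    | succ n ih => rw [pow_succ, mul_assoc, hx, ih]
  obtain ⟨n, hn⟩ := H.nilpotent h h1
  refine le_antisymm ?_ ?_
  · conv_lhs => rw [← key n]
    exact mul_le_mul_left hn x
  · rw [mul_comm]; exact QNCTomonoid.mul_le_self x d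

/-- Cancellation can fail only at the bottom: writing `f = k * g` with `k < 1`, the element `g * x`
is fixed by `k`, hence by powers of `k` that lie below `d`. -/
theorem mul_eq_of_mul_eq (H : NilpotentZero d) {f g x : L} (hd : d ≤ f) (hfg : f < g)
    (h : f * x = g * x) : g * x = d * x := by
  obtain ⟨k, _, hk⟩ := H.exists_mul_eq ((QNCTomonoid.mul_le_self d g).trans hd) hfg.le
  have hk1 : k < 1 := by
    refine (QNCTomonoid.le_one' k).lt_of_ne ?_
    rintro rfl
    rw [one_mul] at hk
    exact hfg.ne' hk
  have h2 : k * (g * x) = g * x := by rw [← mul_assoc, hk, h]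
  have h3 := H.eq_of_mul_eq_self hk1 h2
  refine le_antisymm ?_ (mul_le_mul_left (hd.trans hfg.le) x)
  rw [h3]
  exact mul_le_mul_right ((mul_comm g x).le.trans (QNCTomonoid.mul_le_self x g)) d

/-- The largest square root in `[d, 1]`. -/
theorem exists_sq_eq (H : NilpotentZero d) {x : L} (hx : d ≤ x) :
    ∃ y, d ≤ y ∧ y * y = x ∧ ∀ z, y < z → x < z * z := by
  have hne : {y | d ≤ y ∧ y * y ≤ x}.Nonempty := ⟨d, le_rfl, H.mul_self.le.trans hx⟩
  obtain ⟨h, hh⟩ := QNCTomonoid.exists_isLUB _ hne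
  have hd : d ≤ h := hh.1 ⟨le_rfl, H.mul_self.le.trans hx⟩
  have hmax : ∀ z, h < z → x < z * z := by
    intro z hz
    by_contra! hc
    exact absurd (hh.1 ⟨hd.trans hz.le, hc⟩) (not_le.2 hz)
  refine ⟨h, hd, le_antisymm ?_ ?_, hmax⟩
  · refine (QNCTomonoid.mul_isLUB h _ h hne hh).2 ?_
    rintro _ ⟨y, hy, rfl⟩
    show h * y ≤ x
    rw [mul_comm]
    refine (QNCTomonoid.mul_isLUB y _ h hne hh).2 ?_
    rintro _ ⟨z, hz, rfl⟩
    show y * z ≤ x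
    rcases le_total y z with hyz | hyz
    · exact (mul_le_mul_left hyz z).trans hz.2
    · exact (mul_le_mul_right hyz y).trans hy.2
  · rcases (QNCTomonoid.le_one' h).eq_or_lt with rfl | h1
    · simpa using QNCTomonoid.le_one' x
    have key : ∀ k, k < 1 → k * k * x ≤ h * h := by
      intro k hk
      obtain ⟨h', hlt, hkh⟩ := H.exists_gt_mul_le hd h1 hk
      calc k * k * x ≤ k * k * (h' * h') := mul_le_mul_right (hmax _ hlt).le _
        _ = (k * h') * (k * h') := mul_mul_mul_comm _ _ _ _
        _ ≤ h * h := mul_le_mul' hkh hkh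
    -- The two factors are removed one at a time; replacing both by their maximum reduces to `key`.
    refine H.le_of_forall_mul_le fun k _ hk => H.le_of_forall_mul_le fun k' _ hk' => ?_
    rw [← mul_assoc]
    refine (mul_le_mul_left ?_ x).trans (key (max k k') (max_lt hk hk'))
    exact mul_le_mul' (le_max_right _ _) (le_max_left _ _)

/-- If `z * y ≤ d`, write `t₀ = k₀ * z` with `y < t₀ < z`. Some `t` with `y < t ≤ t₀` satisfies `k₀
* t ≤ y`, and `t` is a multiple of `k₀ * z`, so `t * t ≤ z * y ≤ d`, although `y` is the largest
root of `d`. -/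
theorem lt_mul_of_lt (H : NilpotentZero d) {y : L} (hd : d ≤ y)
    (hmax : ∀ z, y < z → d < z * z) {z : L} (hz : y < z) : d < z * y := by
  by_contra! hc
  have hdiv : ∀ {a b : L}, y ≤ a → a ≤ b → ∃ f, d ≤ f ∧ f * b = a := fun ha hab =>
    H.exists_mul_eq ((QNCTomonoid.mul_le_self d _).trans (hd.trans ha)) hab
  obtain ⟨t₀, h1, h2⟩ := H.dense y z hd hz
  obtain ⟨k₀, _, hk₀⟩ := hdiv h1.le h2.le
  have hk1 : k₀ < 1 := by
    refine (QNCTomonoid.le_one' _).lt_of_ne ?_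
    rintro rfl
    rw [one_mul] at hk₀
    exact h2.ne' hk₀
  have hy1 : y < 1 := hz.trans_le (QNCTomonoid.le_one' z)
  obtain ⟨t', ht', hkt'⟩ := H.exists_gt_mul_le hd hy1 hk1
  have ht : y < min t' t₀ := lt_min ht' h1
  obtain ⟨k₁, _, hk₁⟩ := hdiv ht.le (min_le_right t' t₀)
  refine absurd (hmax _ ht) (not_lt.2 ?_)
  calc min t' t₀ * min t' t₀ = (k₁ * (k₀ * z)) * min t' t₀ := by rw [hk₀, hk₁]
    _ = (z * (k₀ * min t' t₀)) * k₁ := by ac_rfl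
    _ ≤ z * (k₀ * min t' t₀) := QNCTomonoid.mul_le_self _ _
    _ ≤ z * (k₀ * t') := mul_le_mul_right (mul_le_mul_right (min_le_left _ _) _) _
    _ ≤ z * y := mul_le_mul_right hkt' z
    _ ≤ d := hc

end NilpotentZero

/-! ### Powers of the iterated roots -/

/-- Iterated square roots of `d`. -/
structure IsDyadicRoots {L : Type*} [CommMonoid L] [LinearOrder L] (d : L) (s : ℕ → L) :
    Prop where
  zero : s 0 = d
  succ : ∀ n, s (n + 1) * s (n + 1) = s n
  le : ∀ n, d ≤ s n
  lt_mul : ∀ z, s 1 < z → d < z * s 1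

theorem NilpotentZero.exists_isDyadicRoots {L : Type*} [CommMonoid L] [LinearOrder L]
    [QNCTomonoid L] {d : L} (H : NilpotentZero d) : ∃ s, IsDyadicRoots d s := by
  choose! r hr using fun (x : L) (hx : d ≤ x) => H.exists_sq_eq hx
  have hle : ∀ n, d ≤ r^[n] d := by
    intro n
    induction n with
    | zero => exact le_rfl
    | succ n ih => rw [Function.iterate_succ_apply']; exact (hr _ ih).1
  refine ⟨fun n => r^[n] d, rfl, fun n => ?_, hle, fun z hz => ?_⟩
  · rw [Function.iterate_succ_apply']; exact (hr _ (hle n)).2.1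
  · obtain ⟨h1, -, h3⟩ := hr d le_rfl
    exact H.lt_mul_of_lt h1 h3 hz

namespace IsDyadicRoots

variable {L : Type*} [CommMonoid L] [LinearOrder L] {d : L} {s : ℕ → L}

theorem pow_two_pow (hs : IsDyadicRoots d s) (n m : ℕ) : s (n + m) ^ 2 ^ m = s n := by
  induction m with
  | zero => simp
  | succ m ih => rw [pow_succ', pow_mul, sq, ← add_assoc, hs.succ, ih]

theorem pow_self (hs : IsDyadicRoots d s) (n : ℕ) : s n ^ 2 ^ n = d := by
  simpa [hs.zero] using hs.pow_two_pow 0 n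

variable [QNCTomonoid L]

theorem lt_succ (H : NilpotentZero d) (hs : IsDyadicRoots d s) (n : ℕ) : d < s (n + 1) := by
  have hmono : Monotone s := monotone_nat_of_le_succ fun n => by
    rw [← hs.succ n]; exact QNCTomonoid.mul_le_self _ _
  refine lt_of_lt_of_le ?_ (hmono (Nat.le_add_left 1 n))
  rcases (QNCTomonoid.le_one' (s 1)).eq_or_lt with h | h
  · rw [h]; exact H.lt_one
  · simpa using hs.lt_mul 1 h

theorem lt_one (H : NilpotentZero d) (hs : IsDyadicRoots d s) (n : ℕ) : s n < 1 := by
  refine (QNCTomonoid.le_one' _).lt_of_ne fun h => ?_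
  have := hs.pow_self n
  rw [h, one_pow] at this
  exact H.lt_one.ne' this

theorem pow_antitone (s : ℕ → L) (n : ℕ) : Antitone fun j => s n ^ j :=
  antitone_nat_of_succ_le fun j => by
    rw [pow_succ]; exact QNCTomonoid.mul_le_self _ _

theorem pow_succ_lt (H : NilpotentZero d) (hs : IsDyadicRoots d s) {n j : ℕ}
    (h : d < s n ^ j) : s n ^ (j + 1) < s n ^ j := by
  refine (pow_antitone s n j.le_succ).lt_of_ne fun he => ?_
  replace he : s n * s n ^ j = s n ^ j := by rw [← pow_succ']; exact he
  have h2 := H.eq_of_mul_eq_self (hs.lt_one H n) he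
  rw [h2] at h
  exact absurd h (not_lt.2 (QNCTomonoid.mul_le_self _ _))

/-- The exponent `2 ^ n` is the first at which `s n` reaches `d`. For index `n + 1`, the power `2 ^
n` is `s 1` and the one before it is strictly larger; by `lt_mul` their product, of exponent `2 ^ (n
+ 1) - 1`, still exceeds `d`. -/
theorem lt_pow (H : NilpotentZero d) (hs : IsDyadicRoots d s) {n j : ℕ} (hj : j < 2 ^ n) :
    d < s n ^ j := by
  cases n with
  | zero =>
    obtain rfl : j = 0 := by simpa using hj
    simpa using H.lt_one
  | succ n =>
    have hpos : 0 < 2 ^ n := by positivity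
    have h1 : s (n + 1) ^ 2 ^ n = s 1 := by
      have := hs.pow_two_pow 1 n
      rwa [add_comm] at this
    have h2 : s 1 < s (n + 1) ^ (2 ^ n - 1) := by
      have h3 : d < s (n + 1) ^ (2 ^ n - 1) :=
        (h1 ▸ hs.lt_succ H 0).trans_le (pow_antitone s (n + 1) (Nat.sub_le _ _))
      have h4 := hs.pow_succ_lt H h3
      rwa [Nat.sub_add_cancel hpos, h1] at h4
    have h5 := hs.lt_mul _ h2
    rw [← h1, ← pow_add] at h5
    exact h5.trans_le (pow_antitone s (n + 1) (by rw [pow_succ] at hj; omega))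

theorem le_of_pow_le (H : NilpotentZero d) (hs : IsDyadicRoots d s) {n i j : ℕ} (hj : j ≤ 2 ^ n)
    (h : s n ^ i ≤ s n ^ j) : j ≤ i := by
  by_contra! hc
  have h1 := hs.pow_succ_lt H (hs.lt_pow H (hc.trans_le hj))
  exact absurd (h.trans (pow_antitone s n hc)) (not_le.2 h1)

/-- The roots tend to `1`: if `s (N + 1) ≤ h` with `h ^ N ≤ d`, then `s 1 = s (N + 1) ^ 2 ^ N ≤ d`.
-/
theorem exists_lt (H : NilpotentZero d) (hs : IsDyadicRoots d s) {h : L} (h1 : h < 1) :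
    ∃ n, h < s n := by
  obtain ⟨N, hN⟩ := H.nilpotent h h1
  refine ⟨N + 1, ?_⟩
  by_contra! hc
  have h2 : s 1 ≤ h ^ 2 ^ N := by
    have := hs.pow_two_pow 1 N
    rw [← this, add_comm]
    exact pow_le_pow_left' hc _
  have h3 : h ^ 2 ^ N ≤ h ^ N := pow_le_pow_right_of_le_one' h1.le Nat.lt_two_pow_self.le
  exact absurd (hs.lt_succ H 0) (not_lt.2 (h2.trans (h3.trans hN)))

theorem exists_pow_le (hs : IsDyadicRoots d s) {f : L} (hf : d ≤ f) (n : ℕ) :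
    ∃ j, j < 2 ^ n ∧ s n ^ (j + 1) ≤ f ∧ f ≤ s n ^ j := by
  classical
  have hex : ∃ j, s n ^ (j + 1) ≤ f := ⟨2 ^ n - 1, by
    rw [Nat.sub_add_cancel (Nat.two_pow_pos n), hs.pow_self]; exact hf⟩
  refine ⟨Nat.find hex, ?_, Nat.find_spec hex, ?_⟩
  · have : Nat.find hex ≤ 2 ^ n - 1 := Nat.find_min' hex (by
      rw [Nat.sub_add_cancel (Nat.two_pow_pos n), hs.pow_self]; exact hf)
    have : 0 < 2 ^ n := by positivity
    omega
  · rcases h : Nat.find hex with _ | j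
    · simpa using QNCTomonoid.le_one' f
    · have := Nat.find_min hex (m := j) (by omega)
      exact (not_le.1 this).le

end IsDyadicRoots

/-! ### The dyadic logarithm and the isomorphism of `F` with `[0,1]` -/

/-- The dyadic logarithm of `f` with respect to the iterated square roots `s` of `d`. -/
noncomputable def dyadicLog {L : Type*} [CommMonoid L] [LinearOrder L] (s : ℕ → L) (f : L) : ℝ :=
  sInf {q : ℝ | ∃ n j : ℕ, q = j / 2 ^ n ∧ s n ^ j ≤ f}

namespace IsDyadicRoots

variable {L : Type*} [CommMonoid L] [LinearOrder L] {d : L} {s : ℕ → L}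

theorem dyadicLog_le (s : ℕ → L) {f : L} {n j : ℕ} (h : s n ^ j ≤ f) :
    dyadicLog s f ≤ j / 2 ^ n := by
  refine csInf_le ⟨0, ?_⟩ ⟨n, j, rfl, h⟩
  rintro _ ⟨m, i, rfl, -⟩
  positivity

variable [QNCTomonoid L]

theorem le_dyadicLog (H : NilpotentZero d) (hs : IsDyadicRoots d s) {f : L} (hf : d ≤ f)
    {n j : ℕ} (hj : j ≤ 2 ^ n) (h : f ≤ s n ^ j) : (j / 2 ^ n : ℝ) ≤ dyadicLog s f := by
  refine le_csInf ⟨_, 0, 1, rfl, by simpa [hs.zero] using hf⟩ ?_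
  rintro _ ⟨m, i, rfl, hi⟩
  have hle := hi.trans h
  -- Common denominator: both powers are rewritten as powers of `s (n + m)`.
  rw [← hs.pow_two_pow m n, ← hs.pow_two_pow n m, ← pow_mul, ← pow_mul, add_comm m n] at hle
  have h2 : 2 ^ m * j ≤ 2 ^ n * i := by
    refine hs.le_of_pow_le H ?_ hle
    rw [pow_add, mul_comm]
    exact Nat.mul_le_mul_right _ hj
  have h3 : (2 ^ m * j : ℝ) ≤ 2 ^ n * i := by exact_mod_cast h2
  rw [div_le_div_iff₀ (by positivity) (by positivity)]
  linarith

theorem dyadicLog_pow (H : NilpotentZero d) (hs : IsDyadicRoots d s) {n j : ℕ} (hj : j ≤ 2 ^ n) :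
    dyadicLog s (s n ^ j) = j / 2 ^ n :=
  le_antisymm (dyadicLog_le s le_rfl)
    (hs.le_dyadicLog H ((hs.pow_self n).symm.le.trans (pow_antitone s n hj)) hj le_rfl)

theorem dyadicLog_mem (H : NilpotentZero d) (hs : IsDyadicRoots d s) {f : L} (hf : d ≤ f) :
    dyadicLog s f ∈ Set.Icc (0 : ℝ) 1 := by
  constructor
  · simpa using hs.le_dyadicLog H hf (n := 0) (j := 0) (by simp)
      (by simpa using QNCTomonoid.le_one' f)
  · simpa using dyadicLog_le s (f := f) (n := 0) (j := 1) (by simpa [hs.zero] using hf)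

/-- At level `n` each factor lies between consecutive powers of `s n`, so the error is at most `2 /
2 ^ n`. -/
theorem dyadicLog_mul (H : NilpotentZero d) (hs : IsDyadicRoots d s) {f g : L} (hf : d ≤ f)
    (hg : d ≤ g) : dyadicLog s (f * g) = min (dyadicLog s f + dyadicLog s g) 1 := by
  have hfg : d ≤ f * g := H.mul_self.symm.le.trans (mul_le_mul' hf hg)
  have key : ∀ n : ℕ, |dyadicLog s (f * g) - min (dyadicLog s f + dyadicLog s g) 1|
      ≤ 2 * (1 / 2) ^ n := by
    intro n
    obtain ⟨i, hi, hi1, hi2⟩ := hs.exists_pow_le hf n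
    obtain ⟨j, hj, hj1, hj2⟩ := hs.exists_pow_le hg n
    have a1 := dyadicLog_le s hi1
    have a2 := hs.le_dyadicLog H hf hi.le hi2
    have b1 := dyadicLog_le s hj1
    have b2 := hs.le_dyadicLog H hg hj.le hj2
    have c1 := dyadicLog_le s (f := f * g) (n := n) (j := (i + 1) + (j + 1))
      (by rw [pow_add]; exact mul_le_mul' hi1 hj1)
    have c2 : f * g ≤ s n ^ (i + j) := by rw [pow_add]; exact mul_le_mul' hi2 hj2
    have c3 := (hs.dyadicLog_mem H hfg).2
    have hε : (1 / 2 : ℝ) ^ n = 1 / 2 ^ n := by rw [one_div_pow]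
    have hε0 : (0 : ℝ) < 1 / 2 ^ n := by positivity
    push_cast at a1 b1 c1
    simp only [add_div] at a1 b1 c1
    rw [hε, abs_le]
    rcases le_total (i + j) (2 ^ n) with hij | hij
    · have c4 := hs.le_dyadicLog H hfg hij c2
      push_cast at c4
      rw [add_div] at c4
      constructor
      · have := min_le_left (dyadicLog s f + dyadicLog s g) 1
        linarith
      · rcases min_choice (dyadicLog s f + dyadicLog s g) 1 with h | h <;> rw [h] <;> linarith
    -- Here the product has already reached `d`, and the truncation at `1` takes effect.
    · have c4 := hs.le_dyadicLog H hfg le_rfl (c2.trans (pow_antitone s n hij))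
      push_cast at c4
      rw [div_self (by positivity)] at c4
      have h2 : (1 : ℝ) ≤ i / 2 ^ n + j / 2 ^ n := by
        rw [← add_div, le_div_iff₀ (by positivity), one_mul]
        exact_mod_cast hij
      rw [min_eq_right (by linarith)]
      constructor <;> linarith
  have hlim : Filter.Tendsto (fun n : ℕ => 2 * (1 / 2 : ℝ) ^ n) Filter.atTop (nhds 0) := by
    simpa using (tendsto_pow_atTop_nhds_zero_of_lt_one (r := (1 / 2 : ℝ)) (by norm_num)
      (by norm_num)).const_mul 2
  have := ge_of_tendsto' hlim key
  exact sub_eq_zero.1 (abs_eq_zero.1 (le_antisymm this (abs_nonneg _)))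

theorem dyadicLog_pos (H : NilpotentZero d) (hs : IsDyadicRoots d s) {f : L} (hf : d ≤ f)
    (h1 : f < 1) : 0 < dyadicLog s f := by
  obtain ⟨n, hn⟩ := hs.exists_lt H h1
  have := hs.le_dyadicLog H hf (n := n) (j := 1) Nat.one_le_two_pow (by simpa using hn.le)
  exact lt_of_lt_of_le (by positivity) this

theorem dyadicLog_lt_one (H : NilpotentZero d) (hs : IsDyadicRoots d s) {f : L} (hf : d < f) :
    dyadicLog s f < 1 := by
  obtain ⟨n, hn⟩ : ∃ n, d < s n * f := by
    by_contra! hc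
    refine absurd hf (not_lt.2 (H.le_of_forall_mul_le fun k _ hk => ?_))
    obtain ⟨n, hn⟩ := hs.exists_lt H hk
    exact (mul_le_mul_left hn.le f).trans (hc n)
  obtain ⟨j, hj, hj1, hj2⟩ := hs.exists_pow_le hf.le n
  have hj3 : j + 1 < 2 ^ n := by
    by_contra! hc
    have : s n * f ≤ s n ^ (j + 1) := by
      rw [pow_succ']; exact mul_le_mul_right hj2 _
    exact absurd hn (not_lt.2 ((this.trans (pow_antitone s n hc)).trans (hs.pow_self n).le))
  refine (dyadicLog_le s hj1).trans_lt ?_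
  rw [div_lt_one (by positivity)]
  exact_mod_cast hj3

theorem dyadicLog_lt (H : NilpotentZero d) (hs : IsDyadicRoots d s) {f g : L} (hf : d ≤ f)
    (hfg : f < g) : dyadicLog s g < dyadicLog s f := by
  obtain ⟨h, hd, rfl⟩ := H.exists_mul_eq ((QNCTomonoid.mul_le_self d g).trans hf) hfg.le
  have hh1 : h < 1 := (QNCTomonoid.le_one' h).lt_of_ne (by
    rintro rfl
    simp at hfg)
  rw [hs.dyadicLog_mul H hd (hf.trans hfg.le)]
  have := hs.dyadicLog_pos H hd hh1
  exact lt_min (by linarith) (hs.dyadicLog_lt_one H (hf.trans_lt hfg))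

theorem dyadicLog_surj (H : NilpotentZero d) (hs : IsDyadicRoots d s) {t : ℝ}
    (ht : t ∈ Set.Icc (0 : ℝ) 1) : ∃ f, d ≤ f ∧ dyadicLog s f = t := by
  have hdy : ∀ a b : ℝ, 0 ≤ a → a < b → b ≤ 1 →
      ∃ n j : ℕ, j ≤ 2 ^ n ∧ a < j / 2 ^ n ∧ (j / 2 ^ n : ℝ) < b := by
    intro a b ha hab hb
    -- With mesh `2⁻ⁿ < b - a`, the first grid point beyond `a` lies before `b`.
    obtain ⟨n, hn⟩ := exists_pow_lt_of_lt_one (sub_pos.2 hab) (y := (1 / 2 : ℝ)) (by norm_num)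
    have hp : (0 : ℝ) < 2 ^ n := by positivity
    rw [one_div_pow, div_lt_iff₀ hp] at hn
    have h1 := Nat.lt_floor_add_one (a * 2 ^ n)
    have h2 := Nat.floor_le (mul_nonneg ha hp.le)
    have h3 : ((⌊a * 2 ^ n⌋₊ + 1 : ℕ) : ℝ) < b * 2 ^ n := by push_cast; linarith
    refine ⟨n, ⌊a * 2 ^ n⌋₊ + 1, ?_, ?_, ?_⟩
    · have : ((⌊a * 2 ^ n⌋₊ + 1 : ℕ) : ℝ) ≤ (2 ^ n : ℕ) := by
        push_cast at h3 ⊢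
        nlinarith
      exact_mod_cast this
    · rw [lt_div_iff₀ hp]; push_cast; exact h1
    · rw [div_lt_iff₀ hp]; exact h3
  have hanti : ∀ f g, d ≤ f → f ≤ g → dyadicLog s g ≤ dyadicLog s f := by
    intro f g hf hfg
    rcases hfg.eq_or_lt with rfl | h
    · exact le_rfl
    · exact (hs.dyadicLog_lt H hf h).le
  have hd1 : dyadicLog s d = 1 := by
    have := hs.dyadicLog_pow H (n := 0) (j := 1) (by simp)
    simpa [hs.zero] using this
  have hdS : d ∈ {g | d ≤ g ∧ t ≤ dyadicLog s g} := ⟨le_rfl, hd1 ▸ ht.2⟩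
  -- The logarithm is antitone, so the preimage of `t` is sought as the supremum of the elements of
  -- logarithm at least `t`.
  obtain ⟨f, hf⟩ := QNCTomonoid.exists_isLUB {g | d ≤ g ∧ t ≤ dyadicLog s g} ⟨d, hdS⟩
  have hdf : d ≤ f := hf.1 hdS
  have hmem := hs.dyadicLog_mem H hdf
  refine ⟨f, hdf, le_antisymm ?_ ?_⟩
  · by_contra! hc
    obtain ⟨n, j, hj, h1, h2⟩ := hdy _ _ ht.1 hc hmem.2
    rw [← hs.dyadicLog_pow H hj] at h1 h2
    have hdp : d ≤ s n ^ j := (hs.pow_self n).symm.le.trans (pow_antitone s n hj)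
    exact absurd (hanti _ _ hdp (hf.1 ⟨hdp, h1.le⟩)) (not_le.2 h2)
  · by_contra! hc
    obtain ⟨n, j, hj, h1, h2⟩ := hdy _ _ hmem.1 hc ht.2
    rw [← hs.dyadicLog_pow H hj] at h1 h2
    have hdp : d ≤ s n ^ j := (hs.pow_self n).symm.le.trans (pow_antitone s n hj)
    have h3 : s n ^ j < f := by
      by_contra! h
      exact absurd (hanti _ _ hdf h) (not_le.2 h1)
    obtain ⟨g, hg, hlt, -⟩ := hf.exists_between h3
    exact absurd (hg.2.trans (hanti _ _ hdp hlt.le)) (not_le.2 h2)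

end IsDyadicRoots

theorem NilpotentZero.lukasiewiczTomonoid {L : Type*} [CommMonoid L] [LinearOrder L]
    [QNCTomonoid L] {d : L} (H : NilpotentZero d) (F : Submonoid L)
    (hF : ∀ a, a ∈ F ↔ d ≤ a) : LukasiewiczTomonoid F := by
  obtain ⟨s, hs⟩ := H.exists_isDyadicRoots
  have hd : ∀ f : F, d ≤ (f : L) := fun f => (hF _).1 f.2
  let E : F → unitInterval := fun f => ⟨1 - dyadicLog s f, by
    have := hs.dyadicLog_mem H (hd f)
    exact ⟨by linarith [this.2], by linarith [this.1]⟩⟩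
  have hE : ∀ f, (E f : ℝ) = 1 - dyadicLog s f := fun _ => rfl
  have hmono : StrictMono E := fun f g hfg => by
    have := hs.dyadicLog_lt H (hd f) (show (f : L) < g from hfg)
    rw [← Subtype.coe_lt_coe, hE, hE]
    linarith
  have hsurj : Function.Surjective E := fun t => by
    obtain ⟨f, hf, hft⟩ := hs.dyadicLog_surj H (t := 1 - t)
      ⟨by linarith [t.2.2], by linarith [t.2.1]⟩
    refine ⟨⟨f, (hF f).2 hf⟩, Subtype.ext ?_⟩
    rw [hE, hft]
    ring
  refine ⟨hmono.orderIsoOfSurjective E hsurj, ?_, fun f g => ?_⟩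
  · change E 1 = 1
    refine le_antisymm (E 1).2.2 ?_
    obtain ⟨f, hf⟩ := hsurj 1
    rw [← hf]
    exact hmono.monotone (QNCTomonoid.le_one' (f : L))
  · change E (f * g) = lukMul (E f) (E g)
    refine Subtype.ext ?_
    change 1 - dyadicLog s ((f : L) * g) = max ((E f : ℝ) + E g - 1) 0
    rw [hs.dyadicLog_mul H (hd f) (hd g), hE, hE]
    rcases le_total (dyadicLog s f + dyadicLog s g) 1 with h | h
    · rw [min_eq_left h, max_eq_left (by linarith)]; ring
    · rw [min_eq_right h, max_eq_right (by linarith)]; ring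

/-! ### Rigidity of the Łukasiewicz tomonoid -/

theorem lukMul_coe (a b : unitInterval) : (lukMul a b : ℝ) = max ((a : ℝ) + b - 1) 0 := rfl

theorem lukMul_one_left (a : unitInterval) : lukMul 1 a = a := by
  apply Subtype.ext
  rw [lukMul_coe]
  simp [a.2.1]

theorem orderIso_one (ψ : unitInterval ≃o unitInterval) : ψ 1 = 1 := ψ.map_top

/-- The powers `a j` of `1 - 1 / (n + 1)` reach `0` at `j = n + 1`. So do their images, which forces
`ψ (a 1) ≤ a 1`; comparing `x` with the nearest `a j` above it bounds `ψ x` up to `1 / (n + 1)`. -/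
theorem orderIso_lukMul_le (ψ : unitInterval ≃o unitInterval)
    (hψ : ∀ x t, ψ (lukMul x t) = lukMul (ψ x) (ψ t)) (x : unitInterval) : ψ x ≤ x := by
  have h0 : ψ 0 = 0 := ψ.map_bot
  have key : ∀ n : ℕ, (ψ x : ℝ) ≤ x + 1 / ((n : ℝ) + 1) := by
    intro n
    have hn : (0 : ℝ) < (n : ℝ) + 1 := by positivity
    let a : ℕ → unitInterval := fun j =>
      ⟨max (1 - j / ((n : ℝ) + 1)) 0, le_max_right _ _, max_le (by
        have : (0 : ℝ) ≤ j / ((n : ℝ) + 1) := by positivity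
        linarith) zero_le_one⟩
    have ha : ∀ j, (a j : ℝ) = max (1 - j / ((n : ℝ) + 1)) 0 := fun _ => rfl
    have hstep : ∀ j, a (j + 1) = lukMul (a j) (a 1) := by
      intro j
      apply Subtype.ext
      have h1 : (1 : ℝ) / ((n : ℝ) + 1) ≤ 1 := by rw [div_le_one hn]; linarith [n.cast_nonneg (α := ℝ)]
      have h2 : (0 : ℝ) < 1 / ((n : ℝ) + 1) := by positivity
      rw [lukMul_coe, ha, ha, ha]
      push_cast
      rw [add_div, max_eq_left (a := 1 - 1 / ((n : ℝ) + 1)) (by linarith)]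
      rcases le_total (1 - j / ((n : ℝ) + 1)) 0 with h | h
      · rw [max_eq_right h, max_eq_right (by linarith), max_eq_right (by linarith)]
      · rw [max_eq_left h]
        congr 1
        ring
    have ha0 : a 0 = 1 := by
      apply Subtype.ext
      rw [ha]
      simp
    have hpow : ∀ j : ℕ, (ψ (a j) : ℝ) = max (1 - j * (1 - (ψ (a 1) : ℝ))) 0 := by
      intro j
      induction j with
      | zero => rw [ha0, orderIso_one]; simp
      | succ j ih =>
        have hb := (ψ (a 1)).2.2
        rw [hstep, hψ, lukMul_coe, ih]
        push_cast
        rcases le_total (1 - j * (1 - (ψ (a 1) : ℝ))) 0 with h | h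
        · rw [max_eq_right h, max_eq_right (by linarith), max_eq_right (by linarith)]
        · rw [max_eq_left h]
          congr 1
          ring
    have hb : 1 / ((n : ℝ) + 1) ≤ 1 - (ψ (a 1) : ℝ) := by
      have h1 : a (n + 1) = 0 := by
        apply Subtype.ext
        rw [ha]
        push_cast
        rw [div_self hn.ne']
        simp
      have h2 := hpow (n + 1)
      rw [h1, h0] at h2
      have h3 := le_max_left (1 - ((n + 1 : ℕ) : ℝ) * (1 - (ψ (a 1) : ℝ))) 0
      rw [← h2] at h3
      push_cast at h3
      rw [div_le_iff₀ hn]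
      have h4 : ((0 : unitInterval) : ℝ) = 0 := rfl
      linarith
    have hx0 := x.2.1
    have hx1 := x.2.2
    obtain ⟨j, hj⟩ : ∃ j, j = ⌊(1 - (x : ℝ)) * (n + 1)⌋₊ := ⟨_, rfl⟩
    have hj1 : (j : ℝ) / (n + 1) ≤ 1 - x := by
      rw [div_le_iff₀ hn, hj]
      exact Nat.floor_le (mul_nonneg (by linarith) hn.le)
    have hj2 : 1 - (x : ℝ) ≤ j / (n + 1) + 1 / (n + 1) := by
      rw [← add_div, le_div_iff₀ hn, hj]
      exact (Nat.lt_floor_add_one _).le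
    have hxa : x ≤ a j := by
      rw [← Subtype.coe_le_coe, ha]
      exact le_max_of_le_left (by linarith)
    have h5 : (ψ x : ℝ) ≤ ψ (a j) := ψ.monotone hxa
    rw [hpow] at h5
    refine h5.trans (max_le ?_ (by positivity))
    have h6 : (j : ℝ) * (1 / (n + 1)) ≤ j * (1 - (ψ (a 1) : ℝ)) :=
      mul_le_mul_of_nonneg_left hb j.cast_nonneg
    rw [mul_one_div] at h6
    linarith
  have hlim : Filter.Tendsto (fun n : ℕ => (x : ℝ) + 1 / ((n : ℝ) + 1)) Filter.atTop
      (nhds (x : ℝ)) := by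
    simpa using tendsto_one_div_add_atTop_nhds_zero_nat.const_add (x : ℝ)
  have hx : (ψ x : ℝ) ≤ x := ge_of_tendsto' hlim key
  exact hx

/-- The Łukasiewicz tomonoid has no automorphism besides the identity. -/
theorem orderIso_lukMul_eq (ψ : unitInterval ≃o unitInterval)
    (hψ : ∀ x t, ψ (lukMul x t) = lukMul (ψ x) (ψ t)) (x : unitInterval) : ψ x = x := by
  refine le_antisymm (orderIso_lukMul_le ψ hψ x) ?_
  have h := orderIso_lukMul_le ψ.symm (fun x t => by
    rw [OrderIso.symm_apply_eq, hψ, OrderIso.apply_symm_apply, OrderIso.apply_symm_apply]) (ψ x)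
  rwa [OrderIso.symm_apply_apply] at h

/-- A map in `lukMaps` is determined by its value at `1`. Hence the change of coordinates respects
`lukMul`, and rigidity applies. -/
theorem IsCIso.eq_of_lukMaps {X : Type*} [LE X] {Φ : Set (X → X)} {φ φ' : X ≃o unitInterval}
    (h : IsCIso φ Φ lukMaps) (h' : IsCIso φ' Φ lukMaps) : φ = φ' := by
  let ψ : unitInterval ≃o unitInterval := φ'.symm.trans φ
  have hψ : ∀ x t, ψ (lukMul x t) = lukMul (ψ x) (ψ t) := by
    intro x t
    have h1 : (fun y => lukMul y t) ∈ transportMap φ' φ' '' Φ := by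
      rw [← h']; exact ⟨t, rfl⟩
    obtain ⟨g, hg, hgt⟩ := h1
    have h2 : transportMap φ φ g ∈ lukMaps := by rw [h]; exact ⟨g, hg, rfl⟩
    obtain ⟨t', ht'⟩ := h2
    have h3 : ∀ y, ψ (lukMul y t) = lukMul (ψ y) t' := by
      intro y
      have e1 := congrFun hgt y
      have e2 := congrFun ht' (ψ y)
      simp only [transportMap, Function.comp_apply, ψ, OrderIso.trans_apply,
        OrderIso.symm_apply_apply] at e1 e2 ⊢
      rw [e2, ← e1, OrderIso.symm_apply_apply]
    have h4 := h3 1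
    rw [orderIso_one, lukMul_one_left, lukMul_one_left] at h4
    rw [h3, h4]
  ext x
  have := orderIso_lukMul_eq ψ hψ (φ' x)
  simp only [ψ, OrderIso.trans_apply, OrderIso.symm_apply_apply] at this
  rw [this]

/-- This `f` solves `1 + α (f - 1) = r`, so it moves the top of a class to `r`; `α ≥ 1` keeps the
solution in `[0,1]`. -/
theorem exists_coe_eq_of_one_le {M : Type*} [LE M] (e : M ≃o unitInterval) {α : ℝ}
    (hα : 1 ≤ α) (r : unitInterval) : ∃ f, (e f : ℝ) = 1 + ((r : ℝ) - 1) / α := by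
  have h0 := r.2.1
  have h1 := r.2.2
  have hα0 : 0 < α := by linarith
  refine ⟨e.symm ⟨1 + ((r : ℝ) - 1) / α, ?_, ?_⟩, by rw [OrderIso.apply_symm_apply]⟩
  · have : -1 ≤ ((r : ℝ) - 1) / α := by rw [le_div_iff₀ hα0]; linarith
    linarith
  · have : ((r : ℝ) - 1) / α ≤ 0 := div_nonpos_of_nonpos_of_nonneg (by linarith) hα0.le
    linarith

/-! ### The `F`-classes and the action of `F` on them -/

section FilterQuotient

variable {L : Type*} [CommMonoid L] [LinearOrder L] [QNCTomonoid L] {d : L} {F : Submonoid L}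

theorem isCompositionTomonoid_lambdaR (R : FilterQuotient F) :
    IsCompositionTomonoid (LambdaR R) where
  monotone := by
    rintro _ ⟨f, rfl⟩ r r' h
    exact mul_le_mul_right (show (r : L) ≤ r' from h) (f : L)
  total := by
    rintro _ ⟨f, rfl⟩ _ ⟨g, rfl⟩
    rcases le_total (f : L) g with h | h
    · exact Or.inl fun r => mul_le_mul_left h (r : L)
    · exact Or.inr fun r => mul_le_mul_left h (r : L)
  comp_mem := by
    rintro _ ⟨f, rfl⟩ _ ⟨g, rfl⟩
    exact ⟨f * g, funext fun r => Subtype.ext (mul_assoc (f : L) g r)⟩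
  id_mem := ⟨1, funext fun r => Subtype.ext (one_mul (r : L))⟩

/-- Since `d` is the strongest witness for `∼_F`, the supremum `w` of the class of `a` satisfies `d
* w ≤ a` by distributivity, and so stays in the class. -/
theorem filterClass_eq_Icc (H : d * d = d) (hF : ∀ a, a ∈ F ↔ d ≤ a) (R : FilterQuotient F) :
    ∃ w, filterClass R = Set.Icc (d * w) w := by
  have hdF : d ∈ F := (hF d).2 le_rfl
  have hiff : ∀ a b : L, (a : FilterQuotient F) = b ↔ d * b ≤ a ∧ d * a ≤ b := by
    intro a b
    rw [filterQuotient_eq_iff]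
    constructor
    · rintro ⟨⟨f, hf, h1⟩, g, hg, h2⟩
      rw [mul_comm d b, mul_comm d a]
      exact ⟨(mul_le_mul_right ((hF f).1 hf) b).trans h1,
        (mul_le_mul_right ((hF g).1 hg) a).trans h2⟩
    · rintro ⟨h1, h2⟩
      rw [mul_comm] at h1 h2
      exact ⟨⟨d, hdF, h1⟩, d, hdF, h2⟩
  have hle : ∀ x : L, d * x ≤ x := fun x => by
    rw [mul_comm]; exact QNCTomonoid.mul_le_self x d
  induction R using Con.induction_on with
  | H a =>
  have ha : a ∈ filterClass (a : FilterQuotient F) := rfl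
  obtain ⟨w, hw⟩ := QNCTomonoid.exists_isLUB (filterClass (a : FilterQuotient F)) ⟨a, ha⟩
  have haw : a ≤ w := hw.1 ha
  have hdw : d * w ≤ a := by
    refine (QNCTomonoid.mul_isLUB d _ w ⟨a, ha⟩ hw).2 ?_
    rintro _ ⟨x, hx, rfl⟩
    exact ((hiff x a).1 hx).2
  refine ⟨w, Set.ext fun x => ⟨fun hx => ⟨?_, hw.1 hx⟩, fun hx => (hiff x a).2 ⟨?_, ?_⟩⟩⟩
  · have h1 := ((hiff x a).1 hx).1
    calc d * w = d * (d * w) := by rw [← mul_assoc, H]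
      _ ≤ d * a := mul_le_mul_right hdw d
      _ ≤ x := h1
  · exact (mul_le_mul_right haw d).trans hx.1
  · exact (mul_le_mul_right hx.2 d).trans hdw

/-- In the coordinates `e` and `φ`, the element `f * w` of the class `[d * w, w]` is
`(1 + α (f - 1)) ∨ 0`. -/
theorem RhoHasCoefficient.apply_mul_top {e : F ≃o unitInterval} {R : FilterQuotient F}
    {φ : filterClass R ≃o unitInterval} {α : ℝ} (h : RhoHasCoefficient e R φ α)
    {w : filterClass R} (hw : ∀ r : filterClass R, r ≤ w) (f : F) :
    (φ (rho R f w) : ℝ) = max (1 + α * ((e f : ℝ) - 1)) 0 := by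
  have hw1 : φ.symm 1 = w :=
    le_antisymm (hw _) ((OrderIso.le_symm_apply φ).2 (φ w).2.2)
  have := h f 1
  simp only [transportMap, Function.comp_apply, hw1] at this
  exact this

theorem RhoHasCoefficient.apply_rho {e : F ≃o unitInterval} {R : FilterQuotient F}
    {φ : filterClass R ≃o unitInterval} {α : ℝ} (h : RhoHasCoefficient e R φ α)
    (f : F) (r : filterClass R) :
    (φ (rho R f r) : ℝ) = max ((φ r : ℝ) + α * ((e f : ℝ) - 1)) 0 := by
  simpa only [transportMap, Function.comp_apply, OrderIso.symm_apply_apply] using h f (φ r)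

theorem RhoHasCoefficient.isCIso {e : F ≃o unitInterval} {R : FilterQuotient F}
    {φ : filterClass R ≃o unitInterval} {α : ℝ} (hα : 1 ≤ α) (h : RhoHasCoefficient e R φ α) :
    IsCIso φ (LambdaR R) lukMaps := by
  have hα0 : 0 < α := by linarith
  have key : ∀ (f : F) (t : unitInterval), (t : ℝ) = max (1 + α * ((e f : ℝ) - 1)) 0 →
      transportMap φ φ (rho R f) = fun x => lukMul x t := by
    intro f t ht
    funext r
    apply Subtype.ext
    rw [h f r, lukMul_coe, ht]
    have h1 := r.2.2
    rcases le_total (1 + α * ((e f : ℝ) - 1)) 0 with h' | h'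
    · rw [max_eq_right h', max_eq_right (by linarith), max_eq_right (by linarith)]
    · rw [max_eq_left h']
      congr 1
      ring
  refine Set.Subset.antisymm ?_ ?_
  · rintro _ ⟨t, rfl⟩
    obtain ⟨f, hf⟩ := exists_coe_eq_of_one_le e hα t
    refine ⟨_, ⟨f, rfl⟩, key f t ?_⟩
    rw [hf, add_sub_cancel_left, mul_div_cancel₀ _ hα0.ne', max_eq_left] <;> linarith [t.2.1]
  · rintro _ ⟨_, ⟨f, rfl⟩, rfl⟩
    refine ⟨⟨max (1 + α * ((e f : ℝ) - 1)) 0, le_max_right _ _, max_le ?_ zero_le_one⟩,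
      (key f _ rfl).symm⟩
    have := mul_nonneg hα0.le (sub_nonneg.2 (e f).2.2)
    linarith

theorem NilpotentZero.exists_rhoHasCoefficient (H : NilpotentZero d)
    (hF : ∀ a, a ∈ F ↔ d ≤ a) {e : F ≃o unitInterval} (he : IsLukasiewiczIso e)
    (R : FilterQuotient F) (hR : ¬ ∃ a, filterClass R = {a}) :
    ∃ (φ : filterClass R ≃o unitInterval) (α : ℝ), 1 ≤ α ∧ RhoHasCoefficient e R φ α := by
  obtain ⟨w, hw⟩ := filterClass_eq_Icc H.mul_self hF R
  have hmem : ∀ x, x ∈ filterClass R ↔ d * w ≤ x ∧ x ≤ w := fun x => by rw [hw]; rfl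
  have hne : d * w ≠ w := fun h => hR ⟨w, by rw [hw, h, Set.Icc_self]⟩
  obtain ⟨k, ⟨hdk, hkw⟩, hkmax⟩ := exists_isGreatest_mul_le (d := d) (x := w) le_rfl
  have hk : k * w = d * w := le_antisymm hkw (mul_le_mul_left hdk w)
  have hk1 : k < 1 := (QNCTomonoid.le_one' k).lt_of_ne (by
    rintro rfl
    rw [one_mul] at hk
    exact hne hk.symm)
  let K : F := ⟨k, (hF k).2 hdk⟩
  have hκ1 : (e K : ℝ) < 1 := by
    have : e K < e 1 := e.strictMono hk1
    rw [he.1] at this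
    exact this
  obtain ⟨κ, hκ⟩ : ∃ κ : ℝ, κ = e K := ⟨_, rfl⟩
  rw [← hκ] at hκ1
  have hκ0 : 0 ≤ κ := hκ ▸ (e K).2.1
  -- The affine stretch of `[0,1]` onto `[κ, 1]`, the part of `F` that acts injectively on `w`.
  let c : unitInterval → unitInterval := fun t => ⟨κ + (1 - κ) * t, by
    have := mul_nonneg (sub_nonneg.2 hκ1.le) t.2.1
    linarith, by
    have := mul_nonneg (sub_nonneg.2 hκ1.le) (sub_nonneg.2 t.2.2)
    linarith⟩
  have hc : ∀ t, (c t : ℝ) = κ + (1 - κ) * t := fun _ => rfl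
  have hin : ∀ f : F, (f : L) * w ∈ filterClass R := fun f =>
    (hmem _).2 ⟨mul_le_mul_left ((hF _).1 f.2) w, by
      rw [mul_comm]; exact QNCTomonoid.mul_le_self w f⟩
  let σ : F → filterClass R := fun f => ⟨f * w, hin f⟩
  have hσ : ∀ f g : F, e K ≤ e f → f < g → σ f < σ g := by
    intro f g hf hfg
    have hle : (f : L) * w ≤ g * w := mul_le_mul_left (show (f : L) ≤ g from hfg.le) w
    refine lt_of_le_of_ne hle fun heq => ?_
    have h1 : (f : L) * w = g * w := congrArg Subtype.val heq
    have h2 := H.mul_eq_of_mul_eq ((hF _).1 f.2) (show (f : L) < g from hfg) h1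
    have h3 : (g : L) ≤ k := hkmax ⟨(hF _).1 g.2, h2.le⟩
    have h4 : K ≤ f := e.le_iff_le.1 hf
    exact absurd (h4.trans_lt hfg) (not_lt.2 h3)
  let ψ : unitInterval → filterClass R := fun t => σ (e.symm (c t))
  have hψm : StrictMono ψ := by
    intro t t' htt
    refine hσ _ _ ?_ (e.symm.strictMono ?_)
    · rw [OrderIso.apply_symm_apply, ← Subtype.coe_le_coe, hc, ← hκ]
      have := mul_nonneg (sub_nonneg.2 hκ1.le) t.2.1
      linarith
    · rw [← Subtype.coe_lt_coe, hc, hc]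
      have := mul_lt_mul_of_pos_left (show (t : ℝ) < t' from htt) (sub_pos.2 hκ1)
      linarith
  have hψσ : ∀ (f : F) (t : unitInterval), (t : ℝ) = max (((e f : ℝ) - κ) / (1 - κ)) 0 →
      ψ t = σ f := by
    intro f t ht
    have hpos : 0 < 1 - κ := sub_pos.2 hκ1
    rcases le_total (e K) (e f) with h | h
    · have h' : κ ≤ e f := hκ ▸ h
      rw [max_eq_left (div_nonneg (by linarith) hpos.le)] at ht
      have : c t = e f := by
        apply Subtype.ext
        rw [hc, ht, mul_div_cancel₀ _ hpos.ne']
        ring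
      change σ (e.symm (c t)) = σ f
      rw [this, OrderIso.symm_apply_apply]
    · have h' : (e f : ℝ) ≤ κ := hκ ▸ h
      rw [max_eq_right (div_nonpos_of_nonpos_of_nonneg (by linarith) hpos.le)] at ht
      have : c t = e K := by
        apply Subtype.ext
        rw [hc, ht, hκ]
        ring
      change σ (e.symm (c t)) = σ f
      rw [this, OrderIso.symm_apply_apply]
      have hfk : (f : L) ≤ k := show f ≤ K from e.le_iff_le.1 h
      apply Subtype.ext
      change k * w = f * w
      refine le_antisymm ?_ (mul_le_mul_left hfk w)
      rw [hk]
      exact mul_le_mul_left ((hF _).1 f.2) w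
  have hex : ∀ f : F, ∃ t : unitInterval, (t : ℝ) = max (((e f : ℝ) - κ) / (1 - κ)) 0 := by
    intro f
    refine ⟨⟨_, le_max_right _ _, max_le ?_ zero_le_one⟩, rfl⟩
    rw [div_le_one (sub_pos.2 hκ1)]
    linarith [(e f).2.2]
  have hψs : Function.Surjective ψ := by
    rintro ⟨r, hr⟩
    obtain ⟨f, hf, rfl⟩ := H.exists_mul_eq ((hmem r).1 hr).1 ((hmem r).1 hr).2
    obtain ⟨t, ht⟩ := hex ⟨f, (hF f).2 hf⟩
    exact ⟨t, hψσ _ t ht⟩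
  refine ⟨(hψm.orderIsoOfSurjective ψ hψs).symm, 1 / (1 - κ), ?_, ?_⟩
  · rw [le_div_iff₀ (sub_pos.2 hκ1)]
    linarith
  · intro f t
    obtain ⟨t', ht'⟩ := hex (f * e.symm (c t))
    have h1 : rho R f (ψ t) = ψ t' := by
      rw [hψσ _ t' ht']
      exact Subtype.ext (mul_assoc (f : L) _ w).symm
    have h2 : transportMap (hψm.orderIsoOfSurjective ψ hψs).symm
        (hψm.orderIsoOfSurjective ψ hψs).symm (rho R f) t = t' := by
      simp only [transportMap, Function.comp_apply, OrderIso.symm_symm]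
      rw [OrderIso.symm_apply_eq]
      exact h1
    have hpos : 0 < 1 - κ := sub_pos.2 hκ1
    rw [h2, ht', he.2, lukMul_coe, OrderIso.apply_symm_apply, hc]
    have h3 : ((e f : ℝ) + (κ + (1 - κ) * t) - 1 - κ) / (1 - κ)
        = t + 1 / (1 - κ) * ((e f : ℝ) - 1) := by
      field_simp
      ring
    rw [← h3]
    rcases le_total ((e f : ℝ) + (κ + (1 - κ) * t) - 1) 0 with h | h
    · rw [max_eq_right h, max_eq_right, max_eq_right] <;>
        exact div_nonpos_of_nonpos_of_nonneg (by linarith) hpos.le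
    · rw [max_eq_left h]

theorem NilpotentZero.lukasiewiczComposition (H : NilpotentZero d)
    (hF : ∀ a, a ∈ F ↔ d ≤ a) (R : FilterQuotient F) (hR : ¬ ∃ a, filterClass R = {a}) :
    LukasiewiczComposition (LambdaR R) := by
  obtain ⟨e, he⟩ := H.lukasiewiczTomonoid F hF
  obtain ⟨φ, α, hα, h⟩ := H.exists_rhoHasCoefficient hF he R hR
  exact ⟨isCompositionTomonoid_lambdaR R, φ, h.isCIso hα⟩

theorem NilpotentZero.rhoHasCoefficient (H : NilpotentZero d)
    (hF : ∀ a, a ∈ F ↔ d ≤ a) {e : F ≃o unitInterval} (he : IsLukasiewiczIso e)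
    (R : FilterQuotient F) (hR : ¬ ∃ a, filterClass R = {a}) {φ : filterClass R ≃o unitInterval}
    (hφ : IsCIso φ (LambdaR R) lukMaps) : ∃ α : ℝ, 1 ≤ α ∧ RhoHasCoefficient e R φ α := by
  obtain ⟨φ', α, hα, h⟩ := H.exists_rhoHasCoefficient hF he R hR
  rw [← hφ.eq_of_lukMaps (h.isCIso hα)] at h
  exact ⟨α, hα, h⟩

theorem NilpotentZero.of_archimedean (hF : IsUpperSet (F : Set L)) (hF_nontrivial : F ≠ ⊥)
    (hF_arch : ArchimedeanTomonoid F)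
    (h_real : ∃ J : Set ℝ, IsRealInterval J ∧ Nonempty (filterClass (1 : FilterQuotient F) ≃o J))
    (hd : IsLeast (F : Set L) d) : NilpotentZero d where
  mul_self := le_antisymm (QNCTomonoid.mul_le_self d d) (hd.2 (F.mul_mem hd.1 hd.1))
  lt_one := by
    refine (QNCTomonoid.le_one' d).lt_of_ne ?_
    rintro rfl
    exact hF_nontrivial ((Submonoid.eq_bot_iff_forall F).2 fun x hx =>
      le_antisymm (QNCTomonoid.le_one' x) (hd.2 hx))
  dense := by
    intro a b hda hab
    obtain ⟨J, hJ, ⟨i⟩⟩ := h_real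
    have hconn : J.OrdConnected := by
      rcases hJ with ⟨a, rfl⟩ | ⟨a, b, -, rfl | rfl | rfl | rfl⟩ <;> infer_instance
    have hmem : ∀ x, d ≤ x → x ∈ filterClass (1 : FilterQuotient F) := fun x hx =>
      coe_eq_one_of_mem (hF hx hd.1)
    have hlt : i ⟨a, hmem a hda⟩ < i ⟨b, hmem b (hda.trans hab.le)⟩ := i.strictMono hab
    obtain ⟨q, h1, h2⟩ := exists_between (Subtype.coe_lt_coe.2 hlt)
    have hq : q ∈ J := hconn.out (Subtype.coe_prop _) (Subtype.coe_prop _) ⟨h1.le, h2.le⟩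
    have h3 := i.symm.strictMono (show i ⟨a, hmem a hda⟩ < ⟨q, hq⟩ from h1)
    have h4 := i.symm.strictMono (show ⟨q, hq⟩ < i ⟨b, hmem b (hda.trans hab.le)⟩ from h2)
    rw [OrderIso.symm_apply_apply] at h3 h4
    exact ⟨i.symm ⟨q, hq⟩, h3, h4⟩
  nilpotent := by
    intro x hx
    rcases le_or_gt x d with h | h
    · exact ⟨1, by simpa using h⟩
    · obtain ⟨n, -, hn⟩ := hF_arch ⟨d, hd.1⟩ ⟨x, hF h.le hd.1⟩ h hx
      exact ⟨n, hn⟩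

/-! ### The maps from `R` to `S` -/

theorem NilpotentZero.image_lambdaRS (H : NilpotentZero d) (hF : ∀ a, a ∈ F ↔ d ≤ a)
    {e : F ≃o unitInterval} {R T : FilterQuotient F} {φR : filterClass R ≃o unitInterval}
    {φS : filterClass (R * T) ≃o unitInterval} {αR αS : ℝ} (hαR : 1 ≤ αR) (hαS : 1 ≤ αS)
    (hR : RhoHasCoefficient e R φR αR) (hS : RhoHasCoefficient e (R * T) φS αS) :
    ∃ m ∈ Set.Icc (-(αS / αR)) (min (1 - αS / αR) 0),
      transportMap φR φS '' LambdaRS R T =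
        {g : unitInterval → unitInterval | ∃ z ∈ Set.Icc (-(αS / αR)) m,
          ∀ r : unitInterval, (g r : ℝ) = max (αS / αR * (r : ℝ) + z) 0} := by
  have hR0 : 0 < αR := by linarith
  have hS0 : 0 < αS := by linarith
  obtain ⟨w, hw⟩ := filterClass_eq_Icc H.mul_self hF R
  obtain ⟨v, hv⟩ := filterClass_eq_Icc H.mul_self hF T
  have hdle : ∀ x : L, d * x ≤ x := fun x => by
    rw [mul_comm]; exact QNCTomonoid.mul_le_self x d
  let W : filterClass R := ⟨w, by rw [hw]; exact ⟨hdle w, le_rfl⟩⟩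
  let V : filterClass T := ⟨v, by rw [hv]; exact ⟨hdle v, le_rfl⟩⟩
  have hW : ∀ r : filterClass R, r ≤ W := by
    rintro ⟨r, hr⟩
    rw [hw] at hr
    exact hr.2
  have hcomm : ∀ (t : filterClass T) (f : F) (r : filterClass R),
      lambdaMap R T t (rho R f r) = rho (R * T) f (lambdaMap R T t r) := fun t f r =>
    Subtype.ext (mul_left_comm (t : L) f r)
  have hcomm' : ∀ (t : filterClass T) (f : F) (r : filterClass R),
      lambdaMap R T (rho T f t) r = rho (R * T) f (lambdaMap R T t r) := fun t f r =>
    Subtype.ext (mul_assoc (f : L) t r)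
  have hT : ∀ t : filterClass T, ∃ f, t = rho T f V := by
    rintro ⟨t, ht⟩
    have ht' := ht
    rw [hv] at ht'
    obtain ⟨f, hf, h⟩ := H.exists_mul_eq ht'.1 ht'.2
    exact ⟨⟨f, (hF f).2 hf⟩, Subtype.ext h.symm⟩
  have hlam : ∀ (t : filterClass T) (r : unitInterval),
      ((transportMap φR φS (lambdaMap R T t) r : unitInterval) : ℝ) =
        max (αS / αR * r + ((φS (lambdaMap R T t W) : ℝ) - αS / αR)) 0 := by
    intro t r
    -- Writing `r` as `g` acting on the top, `λ_t` becomes the action of `g` on `λ_t W`, a shift by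
    -- `α_S (g - 1) = (α_S / α_R) (r - 1)`.
    obtain ⟨g, hg⟩ := exists_coe_eq_of_one_le e hαR r
    have h1 : φR.symm r = rho R g W := by
      rw [OrderIso.symm_apply_eq]
      apply Subtype.ext
      rw [hR.apply_mul_top hW, hg, add_sub_cancel_left, mul_div_cancel₀ _ hR0.ne', max_eq_left]
        <;> linarith [r.2.1]
    simp only [transportMap, Function.comp_apply]
    rw [h1, hcomm, hS.apply_rho, hg]
    congr 1
    field_simp
    ring
  obtain ⟨c, hc⟩ : ∃ c : ℝ, c = φS (lambdaMap R T V W) := ⟨_, rfl⟩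
  have hc0 : 0 ≤ c := hc ▸ (φS _).2.1
  have hc1 : c ≤ 1 := hc ▸ (φS _).2.2
  -- The element of coordinate `1 - 1 / α_R` and the least element of `F` both send `W` to the
  -- bottom of `R`. Hence they act equally on `λ_V W`, and the latter sends it to `0` because `c ≤ 1
  -- ≤ α_S`.
  have hcle : c ≤ αS / αR := by
    obtain ⟨g, hg⟩ := exists_coe_eq_of_one_le e hαR 0
    have hg0 : φR (rho R g W) = 0 := by
      apply Subtype.ext
      rw [hR.apply_mul_top hW, hg, add_sub_cancel_left, mul_div_cancel₀ _ hR0.ne']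
      simp
    have he0 : e (e.symm 0) = 0 := e.apply_symm_apply 0
    have hd0 : φR (rho R (e.symm 0) W) = 0 := by
      apply Subtype.ext
      rw [hR.apply_mul_top hW, he0, max_eq_right]
      · rfl
      · rw [show ((0 : unitInterval) : ℝ) = 0 from rfl]
        linarith
    have h1 : rho R g W = rho R (e.symm 0) W := φR.injective (hg0.trans hd0.symm)
    have h2 := congrArg (fun x => (φS (lambdaMap R T V x) : ℝ)) h1
    simp only [hcomm, hS.apply_rho, ← hc, he0, hg] at h2
    rw [show ((0 : unitInterval) : ℝ) = 0 from rfl,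
      max_eq_right (b := (0 : ℝ)) (a := c + αS * (0 - 1)) (by linarith)] at h2
    have h3 := le_max_left (c + αS * (1 + (0 - 1) / αR - 1)) 0
    rw [h2] at h3
    have h4 : αS * (1 + (0 - 1) / αR - 1) = -(αS / αR) := by
      field_simp
      ring
    linarith
  refine ⟨c - αS / αR, ⟨by linarith, le_min (by linarith) (by linarith)⟩, ?_⟩
  refine Set.Subset.antisymm ?_ ?_
  · rintro _ ⟨_, ⟨t, rfl⟩, rfl⟩
    refine ⟨_, ⟨?_, ?_⟩, hlam t⟩
    · linarith [(φS (lambdaMap R T t W)).2.1]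
    · obtain ⟨f, rfl⟩ := hT t
      rw [hcomm', hS.apply_rho, ← hc]
      have := mul_nonneg hS0.le (sub_nonneg.2 (e f).2.2)
      have : max (c + αS * ((e f : ℝ) - 1)) 0 ≤ c := max_le (by linarith) hc0
      linarith
  · rintro g ⟨z, ⟨hz1, hz2⟩, hg⟩
    have hx0 : 0 ≤ z + αS / αR := by linarith
    -- Chosen so that `f` moves `λ_V W` from `c` down to `z + α_S / α_R`, the value at `1` of the
    -- required map.
    obtain ⟨f, hf⟩ := exists_coe_eq_of_one_le e hαS ⟨1 + (z + αS / αR - c), by linarith, by linarith⟩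
    refine ⟨_, ⟨rho T f V, rfl⟩, funext fun r => Subtype.ext ?_⟩
    rw [hlam, hg, hcomm', hS.apply_rho, ← hc, hf, add_sub_cancel_left, mul_div_cancel₀ _ hS0.ne']
    rw [max_eq_left (b := (0 : ℝ)) (a := c + (1 + (z + αS / αR - c) - 1)) (by linarith)]
    congr 1
    ring

end FilterQuotient

theorem mainTheorem2 {L : Type*} [CommMonoid L] [LinearOrder L] [QNCTomonoid L]
    (F : Submonoid L) (hF : IsUpperSet (F : Set L)) (hF_nontrivial : F ≠ ⊥)
    (hF_arch : ArchimedeanTomonoid F)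
    (h_real : ∀ Q : FilterQuotient F,
      ∃ J : Set ℝ, IsRealInterval J ∧ Nonempty (filterClass Q ≃o J))
    (hF_least : ∃ d, IsLeast (F : Set L) d)
    (R T : FilterQuotient F) (hT : T < 1) (hRT : OdotMaximal R T)
    (hR : ¬ ∃ a, filterClass R = {a}) (hS : ¬ ∃ a, filterClass (R * T) = {a}) :
    LukasiewiczTomonoid F ∧
    LukasiewiczComposition (LambdaR R) ∧
    LukasiewiczComposition (LambdaR (R * T)) ∧
    ∀ (e : F ≃o unitInterval) (φR : filterClass R ≃o unitInterval)
      (φS : filterClass (R * T) ≃o unitInterval),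
      IsLukasiewiczIso e → IsCIso φR (LambdaR R) lukMaps → IsCIso φS (LambdaR (R * T)) lukMaps →
      ∃ αR αS : ℝ, 1 ≤ αR ∧ 1 ≤ αS ∧
        RhoHasCoefficient e R φR αR ∧ RhoHasCoefficient e (R * T) φS αS ∧
        ∃ m ∈ Set.Icc (-(αS / αR)) (min (1 - αS / αR) 0),
          transportMap φR φS '' LambdaRS R T =
            {g : unitInterval → unitInterval | ∃ z ∈ Set.Icc (-(αS / αR)) m,
              ∀ r : unitInterval, (g r : ℝ) = max (αS / αR * (r : ℝ) + z) 0} := by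

  obtain ⟨d, hd⟩ := hF_least
  have H := NilpotentZero.of_archimedean hF hF_nontrivial hF_arch (h_real 1) hd
  have hmem : ∀ a, a ∈ F ↔ d ≤ a := fun a => ⟨fun h => hd.2 h, fun h => hF h hd.1⟩
  refine ⟨H.lukasiewiczTomonoid F hmem, H.lukasiewiczComposition hmem R hR,
    H.lukasiewiczComposition hmem (R * T) hS, ?_⟩
  intro e φR φS he hφR hφS
  obtain ⟨αR, hαR, hR'⟩ := H.rhoHasCoefficient hmem he R hR hφR
  obtain ⟨αS, hαS, hS'⟩ := H.rhoHasCoefficient hmem he (R * T) hS hφS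
  exact ⟨αR, αS, hαR, hαS, hR', hS', H.image_lambdaRS hmem hαR hαS hR' hS'⟩
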